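/- Let $\alpha>0$ and $0<p\le\infty$. Let $L^p_\alpha$ be the space of all Lebesgue measurable functions $f$ on $\mathbb C$ such that the function $f(z)e^{-\alpha|z|^2/2}$ belongs to $L^p(\mathbb C,dv)$, where $dv$ is Lebesgue area measure, and let the Fock space $F^p_\alpha$ be the set of all entire functions that belong to $L^p_\alpha$. Suppose $f$ is an entire function on $\mathbb C$. Then $f\in F^p_\alpha$ if and only if the function $f'(z)/(1+|z|)$ belongs to $L^p_\alpha$. -/

import Mathlib

open MeasureTheory
open scoped ENNReal

/-- The weighted Lebesgue space `L^p_α` on the complex plane: all (a.e. classes of) Lebesgue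
measurable `f : ℂ → ℂ` such that `f(z) e^{-α|z|²/2}` belongs to `L^p(ℂ, dv)`, where `dv` is
Lebesgue area measure. For `p = ∞` membership in `L^p` is essential boundedness. -/
def gaussianLp (α : ℝ) (p : ℝ≥0∞) : Set (ℂ → ℂ) :=
  {f | MemLp (fun z : ℂ => f z * ((Real.exp (-(α * ‖z‖ ^ 2 / 2)) : ℝ) : ℂ)) p
    (volume : Measure ℂ)}

/-- The Fock space `F^p_α = L^p_α ∩ H(ℂ)`, where `H(ℂ)` is the space of entire functions. -/
def fockSpace (α : ℝ) (p : ℝ≥0∞) : Set (ℂ → ℂ) :=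
  gaussianLp α p ∩ {f | Differentiable ℂ f}

/-! Write F for `gaussianNorm α f` and G for `gaussianNorm α (deriv f) z / (1 + ‖z‖)`. From F to G:
Cauchy's estimate for a Weyl translate bounds G(z) by the supremum of F on the unit disc about z
(`gaussianNorm_deriv_div_le`). From G to F: moving z radially to σ(z) with |σ(z)|² = |z|² - 1 costs
a step of length at most 1/|z|, which cancels the growth 1 + |z|, while the Gaussian gains e^{-α/2}.
Hence F(z) ≤ e^{-α/2} F(σ(z)) + 2 sup G near z (`gaussianNorm_le_radialShift`). Since σ preserves
area, the first term contracts in L^p and is absorbed. For finite p, a sub-mean value inequality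
valid for all p > 0, with Tonelli, keeps local suprema in L^p (`exists_local_bound`). -/

open Metric Set

/-! ### Sub-mean value inequality for every positive exponent -/

/-- A power of the modulus of an entire function is dominated at the origin by its integral over
the unit disc, for every positive exponent. -/
theorem exists_rpow_norm_zero_le_lintegral_ball (p : ℝ) (hp : 0 < p) :
    ∃ C : ℝ≥0∞, C ≠ ∞ ∧ ∀ g : ℂ → ℂ, Differentiable ℂ g →
      ENNReal.ofReal (‖g 0‖ ^ p) ≤ C * ∫⁻ u in ball (0 : ℂ) 1, ENNReal.ofReal (‖g u‖ ^ p) := by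
  set K : ℝ := 2 ^ (2 / p) with hK
  have hK1 : 1 ≤ K := Real.one_le_rpow (by norm_num) (by positivity)
  set ε : ℝ := 1 / (4 * K) with hε
  have hε0 : 0 < ε := by positivity
  have hε4 : ε ≤ 1 / 4 := by
    rw [hε]; gcongr; linarith
  refine ⟨ENNReal.ofReal (4 * 2 ^ p / (Real.pi * ε ^ 2)), ENNReal.ofReal_ne_top, fun g hg => ?_⟩
  -- At a maximum point of this weighted modulus, |g| is at most K m on the disc of radius d, half
  -- the distance to the unit circle. The exponent 2/p makes the p-th power of the weight comparable
  -- to the area of that disc.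
  have hcont : Continuous fun z : ℂ => (1 - ‖z‖) ^ (2 / p) * ‖g z‖ := by
    refine Continuous.mul (Continuous.rpow_const (by fun_prop) fun _ => Or.inr (by positivity)) ?_
    exact hg.continuous.norm
  obtain ⟨z₀, hz₀, hmax⟩ := (isCompact_closedBall (0 : ℂ) 1).exists_isMaxOn
    ⟨0, by simp⟩ hcont.continuousOn
  rw [isMaxOn_iff] at hmax
  have h0 : ‖g 0‖ ≤ (1 - ‖z₀‖) ^ (2 / p) * ‖g z₀‖ := by
    simpa using hmax 0 (by simp)
  rw [mem_closedBall_zero_iff] at hz₀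
  rcases (norm_nonneg (g 0)).eq_or_lt with hg0 | hg0
  · rw [← hg0, Real.zero_rpow hp.ne']; simp
  have hprod := hg0.trans_le h0
  have hm : 0 < ‖g z₀‖ := by
    rcases (norm_nonneg (g z₀)).eq_or_lt with h | h
    · rw [← h] at hprod; simp at hprod
    · exact h
  have hz1 : ‖z₀‖ < 1 := by
    rcases hz₀.eq_or_lt with h | h
    · rw [h, sub_self, Real.zero_rpow (by positivity)] at hprod; simp at hprod
    · exact h
  set d : ℝ := (1 - ‖z₀‖) / 2 with hd
  have hd0 : 0 < d := by rw [hd]; linarith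
  have h2d : 1 - ‖z₀‖ = 2 * d := by rw [hd]; ring
  have hd1 : d ≤ 1 / 2 := by have := norm_nonneg z₀; linarith
  set m := ‖g z₀‖ with hmdef
  have hbound : ∀ w ∈ closedBall z₀ d, ‖g w‖ ≤ K * m := by
    intro w hw
    rw [mem_closedBall, dist_eq_norm] at hw
    have hw1 : ‖w‖ ≤ ‖z₀‖ + d := by
      have := norm_add_le z₀ (w - z₀)
      rw [add_sub_cancel] at this; linarith
    have h1 := hmax w (by rw [mem_closedBall_zero_iff]; linarith)
    have h2 : d ^ (2 / p) ≤ (1 - ‖w‖) ^ (2 / p) :=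
      Real.rpow_le_rpow hd0.le (by linarith) (by positivity)
    have h3 : d ^ (2 / p) * ‖g w‖ ≤ d ^ (2 / p) * (K * m) := by
      calc _ ≤ (1 - ‖w‖) ^ (2 / p) * ‖g w‖ := by gcongr
        _ ≤ _ := h1
        _ = _ := by
          rw [h2d, Real.mul_rpow (by norm_num) hd0.le]; ring
    exact le_of_mul_le_mul_left h3 (by positivity)
  -- The choice ε = 1/(4K) makes the derivative bound times the radius exactly m/2.
  have hlow : ∀ w ∈ ball z₀ (ε * d), m / 2 ≤ ‖g w‖ := by
    intro w hw
    have hder : ∀ x ∈ ball z₀ (ε * d), ‖deriv g x‖ ≤ K * m / (d / 2) := by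
      intro x hx
      refine Complex.norm_deriv_le_of_forall_mem_sphere_norm_le (by positivity)
        hg.diffContOnCl fun y hy => hbound y ?_
      rw [mem_sphere] at hy
      rw [mem_ball] at hx
      rw [mem_closedBall]
      have := dist_triangle y x z₀
      nlinarith
    have h1 := (convex_ball z₀ (ε * d)).norm_image_sub_le_of_norm_deriv_le
      (fun x _ => hg x) hder hw (mem_ball_self (by positivity))
    have h2 : ‖z₀ - w‖ ≤ ε * d := by
      rw [mem_ball, dist_comm, dist_eq_norm] at hw; exact hw.le
    have h3 : ‖g z₀ - g w‖ ≤ m / 2 := by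
      refine h1.trans ?_
      calc K * m / (d / 2) * ‖z₀ - w‖ ≤ K * m / (d / 2) * (ε * d) := by gcongr
        _ = m / 2 := by rw [hε]; field_simp; norm_num
    have h4 := norm_sub_norm_le (g z₀) (g w)
    linarith
  have hsub : ball z₀ (ε * d) ⊆ ball (0 : ℂ) 1 := by
    intro w hw
    rw [mem_ball] at hw ⊢
    have := dist_triangle w z₀ 0
    rw [dist_zero_right z₀] at this
    nlinarith
  have hvol : volume (ball z₀ (ε * d)) = ENNReal.ofReal (Real.pi * (ε * d) ^ 2) := by
    rw [Complex.volume_ball, ENNReal.ofReal_mul Real.pi_pos.le, mul_comm,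
      ENNReal.ofReal_pow (by positivity)]
    congr 1
    rw [← NNReal.coe_real_pi, ENNReal.ofReal_coe_nnreal]
  have hint : ENNReal.ofReal ((m / 2) ^ p) * ENNReal.ofReal (Real.pi * (ε * d) ^ 2) ≤
      ∫⁻ u in ball (0 : ℂ) 1, ENNReal.ofReal (‖g u‖ ^ p) := by
    rw [← hvol, ← setLIntegral_const]
    refine (setLIntegral_mono' measurableSet_ball fun w hw => ?_).trans
      (lintegral_mono_set hsub)
    exact ENNReal.ofReal_le_ofReal (Real.rpow_le_rpow (by positivity) (hlow w hw) hp.le)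
  refine le_trans ?_ (mul_le_mul_right hint _)
  rw [← ENNReal.ofReal_mul (by positivity), ← ENNReal.ofReal_mul (by positivity)]
  refine ENNReal.ofReal_le_ofReal ?_
  calc ‖g 0‖ ^ p ≤ ((1 - ‖z₀‖) ^ (2 / p) * m) ^ p := Real.rpow_le_rpow hg0.le h0 hp.le
    _ = (2 * d) ^ 2 * m ^ p := by
      rw [h2d, Real.mul_rpow (by positivity) hm.le, ← Real.rpow_mul (by positivity),
        div_mul_cancel₀ _ hp.ne', Real.rpow_two]
    _ = _ := by
      rw [Real.div_rpow hm.le (by norm_num)]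
      field_simp
      ring

/-! ### Weyl translates and pointwise estimates -/

/-- The modulus of `h` weighted by the square root of the Gaussian density. -/
noncomputable def gaussianNorm (α : ℝ) (h : ℂ → ℂ) (z : ℂ) : ℝ :=
  ‖h z‖ * Real.exp (-(α * ‖z‖ ^ 2 / 2))

theorem gaussianNorm_nonneg (α : ℝ) (h : ℂ → ℂ) (z : ℂ) : 0 ≤ gaussianNorm α h z := by
  unfold gaussianNorm; positivity

theorem continuous_gaussianNorm (α : ℝ) {h : ℂ → ℂ} (hh : Continuous h) :
    Continuous (gaussianNorm α h) := by
  unfold gaussianNorm; fun_prop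

/-- The Weyl translate of `h` by `z`. -/
noncomputable def weylTranslate (α : ℝ) (h : ℂ → ℂ) (z u : ℂ) : ℂ :=
  h (z + u) * Complex.exp (-(α * u * (starRingEnd ℂ) z) - ((α * ‖z‖ ^ 2 / 2 : ℝ) : ℂ))

theorem differentiable_weylTranslate (α : ℝ) {h : ℂ → ℂ} (hh : Differentiable ℂ h) (z : ℂ) :
    Differentiable ℂ (weylTranslate α h z) := by
  unfold weylTranslate; fun_prop

/-- Expand |z + u|² = |z|² + 2 Re(u z̄) + |u|²: the cross term is the real part of a function
holomorphic in u. -/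
theorem norm_weylTranslate (α : ℝ) (h : ℂ → ℂ) (z u : ℂ) :
    ‖weylTranslate α h z u‖ = gaussianNorm α h (z + u) * Real.exp (α * ‖u‖ ^ 2 / 2) := by
  unfold weylTranslate gaussianNorm
  rw [norm_mul, Complex.norm_exp, mul_assoc ‖h (z + u)‖, ← Real.exp_add]
  congr 2
  simp only [← Complex.normSq_eq_norm_sq, Complex.normSq_apply]
  simp
  ring

theorem norm_weylTranslate_le {α : ℝ} (hα : 0 < α) (h : ℂ → ℂ) (z : ℂ) {u : ℂ} (hu : ‖u‖ ≤ 1) :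
    ‖weylTranslate α h z u‖ ≤ Real.exp (α / 2) * gaussianNorm α h (z + u) := by
  rw [norm_weylTranslate, mul_comm]
  have := gaussianNorm_nonneg α h (z + u)
  gcongr
  nlinarith [norm_nonneg u, mul_nonneg hα.le (sub_nonneg.2 hu)]

/-- Apply the estimate at the origin to the Weyl translate divided by the constant v(z); slow
variation of v then moves the weight under the integral. -/
theorem exists_rpow_gaussianNorm_le_lintegral_ball {α : ℝ} (hα : 0 < α) (p : ℝ) (hp : 0 < p) :
    ∃ C : ℝ≥0∞, C ≠ ∞ ∧ ∀ v : ℂ → ℝ, (∀ z, 0 < v z) → (∀ z w, dist w z ≤ 1 → v w ≤ 2 * v z) →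
      ∀ h : ℂ → ℂ, Differentiable ℂ h → ∀ z : ℂ,
      ENNReal.ofReal ((gaussianNorm α h z / v z) ^ p) ≤
        C * ∫⁻ w in ball z 1, ENNReal.ofReal ((gaussianNorm α h w / v w) ^ p) := by
  obtain ⟨C, hC, H⟩ := exists_rpow_norm_zero_le_lintegral_ball p hp
  refine ⟨C * ENNReal.ofReal ((2 * Real.exp (α / 2)) ^ p),
    ENNReal.mul_ne_top hC ENNReal.ofReal_ne_top, fun v hv hv2 h hh z => ?_⟩
  have key := H (fun u => weylTranslate α h z u / (v z : ℂ))
    ((differentiable_weylTranslate α hh z).div_const _)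
  have h0 : ‖weylTranslate α h z 0 / (v z : ℂ)‖ = gaussianNorm α h z / v z := by
    rw [norm_div, norm_weylTranslate, Complex.norm_real, Real.norm_of_nonneg (hv z).le]
    simp
  rw [h0] at key
  refine key.trans ?_
  rw [mul_assoc]
  refine mul_le_mul_right ?_ _
  have htrans : ∫⁻ w in ball z 1, ENNReal.ofReal ((gaussianNorm α h w / v w) ^ p) =
      ∫⁻ u in ball (0 : ℂ) 1, ENNReal.ofReal ((gaussianNorm α h (z + u) / v (z + u)) ^ p) := by
    rw [← lintegral_indicator measurableSet_ball, ← lintegral_indicator measurableSet_ball,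
      ← lintegral_add_left_eq_self _ z]
    refine lintegral_congr fun u => ?_
    simp [indicator, mem_ball, dist_eq_norm]
  rw [htrans, ← lintegral_const_mul' _ _ ENNReal.ofReal_ne_top]
  refine setLIntegral_mono' measurableSet_ball fun u hu => ?_
  rw [mem_ball_zero_iff] at hu
  rw [← ENNReal.ofReal_mul (by positivity)]
  refine ENNReal.ofReal_le_ofReal ?_
  have hF := gaussianNorm_nonneg α h (z + u)
  rw [← Real.mul_rpow (by positivity) (div_nonneg hF (hv _).le)]
  refine Real.rpow_le_rpow (norm_nonneg _) ?_ hp.le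
  rw [norm_div, Complex.norm_real, Real.norm_of_nonneg (hv z).le]
  have h1 := norm_weylTranslate_le hα h z hu.le
  have h2 := hv2 z (z + u) (by simpa [dist_eq_norm] using hu.le)
  rw [mul_div_assoc', div_le_div_iff₀ (hv _) (hv _)]
  calc _ ≤ (Real.exp (α / 2) * gaussianNorm α h (z + u)) * (2 * v z) := by
        have := hv (z + u); gcongr
    _ = _ := by ring

/-- The derivative of the Weyl translate at 0 is f'(z) - α z̄ f(z) up to the Gaussian factor. Cauchy
bounds it on the unit circle, and dividing by 1 + |z| tames the second term. -/
theorem gaussianNorm_deriv_div_le {α : ℝ} (hα : 0 < α) {f : ℂ → ℂ} (hf : Differentiable ℂ f)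
    (z : ℂ) {B : ℝ} (hB : ∀ w ∈ closedBall z 1, gaussianNorm α f w ≤ B) :
    gaussianNorm α (deriv f) z / (1 + ‖z‖) ≤ (Real.exp (α / 2) + α) * B := by
  have hB0 : gaussianNorm α f z ≤ B := hB z (mem_closedBall_self zero_le_one)
  have hBn : 0 ≤ B := (gaussianNorm_nonneg _ _ _).trans hB0
  set E : ℂ := Complex.exp (-((α * ‖z‖ ^ 2 / 2 : ℝ) : ℂ)) with hE
  have hEn : ‖E‖ = Real.exp (-(α * ‖z‖ ^ 2 / 2)) := by
    rw [hE, Complex.norm_exp, ← Complex.ofReal_neg, Complex.ofReal_re]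
  have hder : HasDerivAt (weylTranslate α f z)
      (deriv f z * E + f z * (E * (-(α * (starRingEnd ℂ) z)))) 0 := by
    have h1 : HasDerivAt (fun u => f (z + u)) (deriv f z) 0 := by
      have : HasDerivAt f (deriv f z) (z + 0) := by rw [add_zero]; exact (hf z).hasDerivAt
      exact this.comp_const_add z 0
    have h2 : HasDerivAt (fun u : ℂ => -(α * u * (starRingEnd ℂ) z) -
        ((α * ‖z‖ ^ 2 / 2 : ℝ) : ℂ)) (-(α * (starRingEnd ℂ) z)) 0 := by
      have := ((((hasDerivAt_id (0 : ℂ)).const_mul (α : ℂ)).mul_const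
        ((starRingEnd ℂ) z)).neg).sub_const (((α * ‖z‖ ^ 2 / 2 : ℝ) : ℂ))
      simpa using this
    have h3 := h1.mul h2.cexp
    have h4 : weylTranslate α f z = (fun u => f (z + u)) * fun u : ℂ =>
        Complex.exp (-(α * u * (starRingEnd ℂ) z) - ((α * ‖z‖ ^ 2 / 2 : ℝ) : ℂ)) := rfl
    rw [h4]
    simpa [hE] using h3
  have hc : ‖deriv (weylTranslate α f z) 0‖ ≤ Real.exp (α / 2) * B / 1 := by
    refine Complex.norm_deriv_le_of_forall_mem_sphere_norm_le one_pos
      (differentiable_weylTranslate α hf z).diffContOnCl fun u hu => ?_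
    rw [mem_sphere_zero_iff_norm] at hu
    refine (norm_weylTranslate_le hα f z hu.le).trans ?_
    have := hB (z + u) (by simp [mem_closedBall, dist_eq_norm, hu])
    gcongr
  rw [hder.deriv, div_one] at hc
  have h4 : gaussianNorm α (deriv f) z ≤
      Real.exp (α / 2) * B + α * ‖z‖ * gaussianNorm α f z := by
    have h5 := norm_sub_norm_le (deriv f z * E) (-(f z * (E * (-(α * (starRingEnd ℂ) z)))))
    rw [sub_neg_eq_add, norm_neg] at h5
    have h6 : ‖f z * (E * (-(α * (starRingEnd ℂ) z)))‖ = α * ‖z‖ * gaussianNorm α f z := by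
      simp only [norm_mul, norm_neg, hEn, gaussianNorm, Complex.norm_real, RCLike.norm_conj,
        Real.norm_of_nonneg hα.le]
      ring
    have h7 : ‖deriv f z * E‖ = gaussianNorm α (deriv f) z := by
      rw [norm_mul, hEn, gaussianNorm]
    rw [h6, h7] at h5
    linarith
  have hz := norm_nonneg z
  rw [div_le_iff₀ (by positivity)]
  have h8 : α * ‖z‖ * gaussianNorm α f z ≤ α * ‖z‖ * B := by gcongr
  have h9 : 0 ≤ Real.exp (α / 2) * B * ‖z‖ := by positivity
  have h10 : 0 ≤ α * B := by positivity
  nlinarith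

/-! ### The radial shift and the mean value estimate -/

/-- The radial contraction which subtracts `1` from the squared modulus. -/
noncomputable def radialShift (z : ℂ) : ℂ :=
  ((√(‖z‖ ^ 2 - 1) / ‖z‖ : ℝ) : ℂ) * z

theorem norm_radialShift {z : ℂ} (hz : 1 ≤ ‖z‖) : ‖radialShift z‖ = √(‖z‖ ^ 2 - 1) := by
  rw [radialShift, norm_mul, Complex.norm_real, Real.norm_of_nonneg (by positivity)]
  field_simp

theorem norm_sq_radialShift {z : ℂ} (hz : 1 ≤ ‖z‖) : ‖radialShift z‖ ^ 2 = ‖z‖ ^ 2 - 1 := by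
  rw [norm_radialShift hz, Real.sq_sqrt (by nlinarith)]

theorem norm_sub_radialShift_le {z : ℂ} (hz : 1 ≤ ‖z‖) : ‖z - radialShift z‖ ≤ 1 / ‖z‖ := by
  have h0 : 0 < ‖z‖ := by linarith
  set s := √(‖z‖ ^ 2 - 1) with hs
  have hs0 : 0 ≤ s := Real.sqrt_nonneg _
  have hs2 : s ^ 2 = ‖z‖ ^ 2 - 1 := Real.sq_sqrt (by nlinarith)
  have hsz : s ≤ ‖z‖ := by nlinarith
  have h1 : z - radialShift z = ((1 - s / ‖z‖ : ℝ) : ℂ) * z := by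
    rw [radialShift]; push_cast; ring
  have h2 : 0 ≤ 1 - s / ‖z‖ := by
    rw [sub_nonneg, div_le_one h0]; exact hsz
  rw [h1, norm_mul, Complex.norm_real, Real.norm_of_nonneg h2, sub_mul, div_mul_cancel₀ _ h0.ne',
    le_div_iff₀ h0]
  nlinarith

theorem gaussianNorm_le_radialShift {α : ℝ} (hα : 0 < α) {f : ℂ → ℂ} (hf : Differentiable ℂ f)
    {z : ℂ} (hz : 1 ≤ ‖z‖) {B : ℝ}
    (hB : ∀ w ∈ closedBall z 1, gaussianNorm α (deriv f) w / (1 + ‖w‖) ≤ B) :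
    gaussianNorm α f z ≤ Real.exp (-(α / 2)) * gaussianNorm α f (radialShift z) + 2 * B := by
  have h0 : 0 < ‖z‖ := by linarith
  have hBn : 0 ≤ B := (div_nonneg (gaussianNorm_nonneg _ _ _) (by positivity)).trans
    (hB z (mem_closedBall_self zero_le_one))
  have hd := norm_sub_radialShift_le hz
  have hd1 : 1 / ‖z‖ ≤ 1 := by rw [div_le_one h0]; exact hz
  -- On the first disc the inverse Gaussian is largest at |z|; on the second, B applies. The
  -- intersection is convex and contains both endpoints.
  have hder : ∀ w ∈ closedBall (0 : ℂ) ‖z‖ ∩ closedBall z 1,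
      ‖deriv f w‖ ≤ (1 + ‖z‖) * B * Real.exp (α * ‖z‖ ^ 2 / 2) := by
    rintro w ⟨hw, hw1⟩
    rw [mem_closedBall_zero_iff] at hw
    have h1 := hB w hw1
    rw [div_le_iff₀ (by positivity), gaussianNorm, Real.exp_neg, ← div_eq_mul_inv,
      div_le_iff₀ (Real.exp_pos _)] at h1
    refine h1.trans ?_
    rw [mul_comm B]
    gcongr
  have hnz : ‖radialShift z‖ ≤ ‖z‖ :=
    (sq_le_sq₀ (norm_nonneg _) h0.le).1 (by rw [norm_sq_radialShift hz]; linarith)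
  have h1 := ((convex_closedBall (0 : ℂ) ‖z‖).inter
    (convex_closedBall z 1)).norm_image_sub_le_of_norm_deriv_le (fun x _ => hf x) hder
    (x := radialShift z) (y := z)
    ⟨by rwa [mem_closedBall_zero_iff], by
      rw [mem_closedBall, dist_comm, dist_eq_norm]; exact hd.trans hd1⟩
    ⟨by rw [mem_closedBall_zero_iff], mem_closedBall_self zero_le_one⟩
  have h2 : ‖f z‖ ≤ ‖f (radialShift z)‖ + 2 * B * Real.exp (α * ‖z‖ ^ 2 / 2) := by
    have h3 := norm_sub_norm_le (f z) (f (radialShift z))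
    have h4 : (1 + ‖z‖) * B * Real.exp (α * ‖z‖ ^ 2 / 2) * ‖z - radialShift z‖ ≤
        2 * B * Real.exp (α * ‖z‖ ^ 2 / 2) := by
      calc _ ≤ (1 + ‖z‖) * B * Real.exp (α * ‖z‖ ^ 2 / 2) * (1 / ‖z‖) := by gcongr
        _ = (1 + ‖z‖) / ‖z‖ * (B * Real.exp (α * ‖z‖ ^ 2 / 2)) := by ring
        _ ≤ 2 * (B * Real.exp (α * ‖z‖ ^ 2 / 2)) := by
          gcongr
          rw [div_le_iff₀ h0]; linarith
        _ = _ := by ring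
    linarith
  have h5 : Real.exp (-(α * ‖z‖ ^ 2 / 2)) =
      Real.exp (-(α / 2)) * Real.exp (-(α * ‖radialShift z‖ ^ 2 / 2)) := by
    rw [← Real.exp_add, norm_sq_radialShift hz]; congr 1; ring
  calc gaussianNorm α f z ≤ (‖f (radialShift z)‖ + 2 * B * Real.exp (α * ‖z‖ ^ 2 / 2)) *
        Real.exp (-(α * ‖z‖ ^ 2 / 2)) := by unfold gaussianNorm; gcongr
    _ = ‖f (radialShift z)‖ * Real.exp (-(α * ‖z‖ ^ 2 / 2)) + 2 * B *
        (Real.exp (α * ‖z‖ ^ 2 / 2) * Real.exp (-(α * ‖z‖ ^ 2 / 2))) := by ring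
    _ = _ := by
      rw [← Real.exp_add, add_neg_cancel, Real.exp_zero, mul_one, h5]
      unfold gaussianNorm; ring

/-! ### Tonelli and area preservation -/

theorem lintegral_lintegral_ball {φ : ℂ → ℝ≥0∞} (hφ : Measurable φ) (r : ℝ) :
    ∫⁻ z, ∫⁻ w in ball z r, φ w = volume (ball (0 : ℂ) r) * ∫⁻ w, φ w := by
  have h1 : ∀ z : ℂ, ∫⁻ w in ball z r, φ w = ∫⁻ w, {q : ℂ × ℂ | dist q.2 q.1 < r}.indicator
      (fun q => φ q.2) (z, w) := by
    intro z
    rw [← lintegral_indicator measurableSet_ball]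
    rfl
  have hS : MeasurableSet {q : ℂ × ℂ | dist q.2 q.1 < r} :=
    measurableSet_lt (by fun_prop) (by fun_prop)
  simp_rw [h1]
  rw [lintegral_lintegral_swap (f := fun z w => {q : ℂ × ℂ | dist q.2 q.1 < r}.indicator
    (fun q => φ q.2) (z, w)) ((hφ.comp measurable_snd).indicator hS).aemeasurable]
  rw [← lintegral_const_mul _ hφ]
  refine lintegral_congr fun w => ?_
  have h2 : ∀ z : ℂ, {q : ℂ × ℂ | dist q.2 q.1 < r}.indicator (fun q => φ q.2) (z, w) =
      (ball w r).indicator (fun _ => φ w) z := by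
    intro z
    simp [indicator, mem_ball, dist_comm]
  simp_rw [h2]
  rw [lintegral_indicator measurableSet_ball, setLIntegral_const, mul_comm,
    Complex.volume_ball, Complex.volume_ball]

theorem measurable_radialShift : Measurable radialShift := by
  unfold radialShift; fun_prop

/-- Substituting s² = r² - 1 gives s ds = r dr. -/
theorem lintegral_Ioi_sqrt_sub_one (G : ℝ → ℝ≥0∞) :
    ∫⁻ r in Ioi (1 : ℝ), ENNReal.ofReal r * G (√(r ^ 2 - 1)) =
      ∫⁻ s in Ioi (0 : ℝ), ENNReal.ofReal s * G s := by
  have himg : (fun r : ℝ => √(r ^ 2 - 1)) '' Ioi 1 = Ioi 0 := by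
    ext s
    simp only [mem_image, mem_Ioi]
    constructor
    · rintro ⟨r, hr, rfl⟩
      exact Real.sqrt_pos.2 (by nlinarith)
    · intro hs
      refine ⟨√(s ^ 2 + 1), ?_, ?_⟩
      · rw [Real.lt_sqrt zero_le_one]; nlinarith
      · rw [Real.sq_sqrt (by positivity), add_sub_cancel_right, Real.sqrt_sq hs.le]
  have hinj : InjOn (fun r : ℝ => √(r ^ 2 - 1)) (Ioi 1) := by
    intro a ha b hb hab
    rw [mem_Ioi] at ha hb
    have h1 := (Real.sqrt_inj (by nlinarith) (by nlinarith)).1 hab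
    exact (sq_eq_sq₀ (by linarith) (by linarith)).1 (by linarith)
  have hderiv : ∀ r ∈ Ioi (1 : ℝ),
      HasDerivWithinAt (fun r : ℝ => √(r ^ 2 - 1)) (r / √(r ^ 2 - 1)) (Ioi 1) r := by
    intro r hr
    rw [mem_Ioi] at hr
    have h1 : HasDerivAt (fun r : ℝ => r ^ 2 - 1) (2 * r) r := by
      simpa using (hasDerivAt_pow 2 r).sub_const 1
    have h2 := h1.sqrt (by nlinarith)
    rw [mul_div_mul_left _ _ two_ne_zero] at h2
    exact h2.hasDerivWithinAt
  rw [← himg, lintegral_image_eq_lintegral_abs_deriv_mul measurableSet_Ioi hderiv hinj]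
  refine setLIntegral_congr_fun measurableSet_Ioi fun r hr => ?_
  rw [mem_Ioi] at hr
  have hs : 0 < √(r ^ 2 - 1) := Real.sqrt_pos.2 (by nlinarith)
  rw [← mul_assoc, ← ENNReal.ofReal_mul (abs_nonneg _), abs_of_nonneg (by positivity),
    div_mul_cancel₀ _ hs.ne']

theorem radialShift_polarCoord_symm {r : ℝ} (hr : 1 < r) (θ : ℝ) :
    radialShift (Complex.polarCoord.symm (r, θ)) = Complex.polarCoord.symm (√(r ^ 2 - 1), θ) := by
  have h0 : (r : ℂ) ≠ 0 := by
    rw [Complex.ofReal_ne_zero]; linarith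
  rw [radialShift, Complex.norm_polarCoord_symm, Complex.polarCoord_symm_apply,
    Complex.polarCoord_symm_apply, abs_of_pos (by simp; linarith)]
  push_cast
  field_simp

/-- The radial shift preserves area. -/
theorem lintegral_radialShift {ψ : ℂ → ℝ≥0∞} (hψ : Measurable ψ) :
    ∫⁻ z in {z : ℂ | 1 < ‖z‖}, ψ (radialShift z) = ∫⁻ z, ψ z := by
  have hmeasS : MeasurableSet {z : ℂ | 1 < ‖z‖} := measurableSet_lt (by fun_prop) (by fun_prop)
  have hpolar : ∀ φ : ℂ → ℝ≥0∞, Measurable φ → ∫⁻ z, φ z =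
      ∫⁻ θ in Ioo (-Real.pi) Real.pi, ∫⁻ r in Ioi (0 : ℝ),
        ENNReal.ofReal r * φ (Complex.polarCoord.symm (r, θ)) := by
    intro φ hφ
    rw [← Complex.lintegral_comp_polarCoord_symm, polarCoord_target, Measure.volume_eq_prod,
      setLIntegral_prod_symm]
    · rfl
    · refine Measurable.aemeasurable ?_
      refine Measurable.smul (measurable_fst.ennreal_ofReal) (hφ.comp ?_)
      have : (Complex.polarCoord.symm : ℝ × ℝ → ℂ) = fun q : ℝ × ℝ =>
        (q.1 : ℂ) * (Real.cos q.2 + Real.sin q.2 * Complex.I) := by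
        funext q; exact Complex.polarCoord_symm_apply q
      rw [this]
      fun_prop
  rw [← lintegral_indicator hmeasS, hpolar ψ hψ,
    hpolar ({z : ℂ | 1 < ‖z‖}.indicator fun z => ψ (radialShift z))
      ((hψ.comp measurable_radialShift).indicator hmeasS)]
  refine lintegral_congr fun θ => ?_
  rw [← lintegral_Ioi_sqrt_sub_one fun s => ψ (Complex.polarCoord.symm (s, θ)),
    ← lintegral_indicator measurableSet_Ioi,
    ← lintegral_indicator measurableSet_Ioi]
  refine lintegral_congr fun r => ?_
  by_cases hr : 1 < r
  · have hr0 : 0 < r := by linarith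
    have hn : 1 < ‖(Complex.polarCoord.symm (r, θ) : ℂ)‖ := by
      rw [Complex.norm_polarCoord_symm, abs_of_pos hr0]; exact hr
    rw [indicator_of_mem (mem_Ioi.2 hr0), indicator_of_mem (mem_Ioi.2 hr),
      indicator_of_mem (by exact hn), radialShift_polarCoord_symm hr]
  · rw [indicator_of_notMem (s := Ioi (1 : ℝ)) (by simpa using hr)]
    by_cases hr0 : 0 < r
    · have hn : ¬ 1 < ‖(Complex.polarCoord.symm (r, θ) : ℂ)‖ := by
        rw [Complex.norm_polarCoord_symm, abs_of_pos hr0]; exact hr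
      rw [indicator_of_mem (mem_Ioi.2 hr0), indicator_of_notMem (by exact hn), mul_zero]
    · rw [indicator_of_notMem (by simpa using hr0)]

/-! ### Membership criteria and local suprema -/

theorem memLp_top_iff_of_continuous {Φ : ℂ → ℂ} (hΦ : Continuous Φ) :
    MemLp Φ ∞ (volume : Measure ℂ) ↔ ∃ B : ℝ, ∀ z, ‖Φ z‖ ≤ B := by
  constructor
  · intro h
    refine ⟨(eLpNormEssSup Φ volume).toReal, fun z => ?_⟩
    have hfin : eLpNormEssSup Φ (volume : Measure ℂ) ≠ ∞ := by
      have := h.2; rw [eLpNorm_exponent_top] at this; exact this.ne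
    -- A set of full measure is dense; being also closed, it is the whole plane.
    have hd : Dense {z : ℂ | ‖Φ z‖ ≤ (eLpNormEssSup Φ volume).toReal} := by
      refine Measure.dense_of_ae (μ := (volume : Measure ℂ)) ?_
      filter_upwards [ae_le_eLpNormEssSup (f := Φ) (μ := (volume : Measure ℂ))] with z hz
      rw [← toReal_enorm]
      exact ENNReal.toReal_mono hfin hz
    have hc : IsClosed {z : ℂ | ‖Φ z‖ ≤ (eLpNormEssSup Φ volume).toReal} :=
      isClosed_le hΦ.norm continuous_const
    have hu := hd.closure_eq
    rw [hc.closure_eq] at hu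
    exact hu.ge (mem_univ z)
  · rintro ⟨B, hB⟩
    exact memLp_top_of_bound hΦ.aestronglyMeasurable B (Filter.Eventually.of_forall hB)

theorem memLp_iff_lintegral_of_continuous {Φ : ℂ → ℂ} (hΦ : Continuous Φ) {p : ℝ≥0∞} (hp : p ≠ 0)
    (hp' : p ≠ ∞) : MemLp Φ p (volume : Measure ℂ) ↔
      ∫⁻ z, ENNReal.ofReal (‖Φ z‖ ^ p.toReal) < ∞ := by
  rw [MemLp, and_iff_right hΦ.aestronglyMeasurable,
    eLpNorm_lt_top_iff_lintegral_rpow_enorm_lt_top hp hp']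
  refine iff_of_eq (congrArg (· < ∞) (lintegral_congr fun z => ?_))
  rw [← ENNReal.ofReal_rpow_of_nonneg (norm_nonneg _) ENNReal.toReal_nonneg, ofReal_norm]

/-- If the weighted modulus of an entire function is `p`-integrable, its local suprema are
controlled by a function of finite integral. -/
theorem exists_local_bound {α : ℝ} (hα : 0 < α) {p : ℝ} (hp : 0 < p) {v : ℂ → ℝ}
    (hv : ∀ z, 0 < v z) (hv2 : ∀ z w, dist w z ≤ 1 → v w ≤ 2 * v z) (hvc : Continuous v)
    {h : ℂ → ℂ} (hh : Differentiable ℂ h)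
    (hint : ∫⁻ z, ENNReal.ofReal ((gaussianNorm α h z / v z) ^ p) < ∞) :
    ∃ B : ℂ → ℝ, (∀ z, 0 ≤ B z) ∧
      (∀ z, ∀ w ∈ closedBall z 1, gaussianNorm α h w / v w ≤ B z) ∧
      ∫⁻ z, ENNReal.ofReal (B z ^ p) < ∞ := by
  obtain ⟨C, hC, H⟩ := exists_rpow_gaussianNorm_le_lintegral_ball hα p hp
  set φ : ℂ → ℝ≥0∞ := fun w => ENNReal.ofReal ((gaussianNorm α h w / v w) ^ p) with hφ
  have hφm : Measurable φ := by
    have h1 : Continuous fun w => gaussianNorm α h w / v w :=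
      (continuous_gaussianNorm α hh.continuous).div hvc fun z => (hv z).ne'
    exact (h1.rpow_const fun _ => Or.inr hp.le).measurable.ennreal_ofReal
  -- Radius 2 contains the unit ball about every w within distance 1 of z.
  set A : ℂ → ℝ≥0∞ := fun z => C * ∫⁻ w in ball z 2, φ w with hA
  have hAfin : ∀ z, A z ≠ ∞ := fun z =>
    ENNReal.mul_ne_top hC ((setLIntegral_le_lintegral _ _).trans_lt hint).ne
  have hBp : ∀ z, ENNReal.ofReal (((A z).toReal ^ (1 / p)) ^ p) = A z := fun z => by
    rw [← Real.rpow_mul ENNReal.toReal_nonneg, one_div_mul_cancel hp.ne', Real.rpow_one,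
      ENNReal.ofReal_toReal (hAfin z)]
  refine ⟨fun z => (A z).toReal ^ (1 / p), fun z => by positivity, fun z w hw => ?_, ?_⟩
  · have h1 : ENNReal.ofReal ((gaussianNorm α h w / v w) ^ p) ≤
        ENNReal.ofReal (((A z).toReal ^ (1 / p)) ^ p) := by
      rw [hBp]
      refine (H v hv hv2 h hh w).trans (mul_le_mul_right (lintegral_mono_set ?_) _)
      exact ball_subset_ball' (by rw [mem_closedBall] at hw; linarith)
    rw [ENNReal.ofReal_le_ofReal_iff (by positivity)] at h1
    exact (Real.rpow_le_rpow_iff (div_nonneg (gaussianNorm_nonneg _ _ _) (hv w).le)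
      (by positivity) hp).1 h1
  · simp only [hBp]
    rw [hA, lintegral_const_mul' _ _ hC, lintegral_lintegral_ball hφm]
    exact ENNReal.mul_lt_top hC.lt_top (ENNReal.mul_lt_top measure_ball_lt_top hint)

/-! ### Absorption along the radial shift -/

/-- Compare b with (1 - q)a/2. This serves all p > 0 at once and keeps the coefficient of a^p below
1, as absorption requires. -/
theorem rpow_mul_add_le {q : ℝ} (hq0 : 0 ≤ q) (hq1 : q < 1) {p : ℝ} (hp : 0 < p) {a b : ℝ}
    (ha : 0 ≤ a) (hb : 0 ≤ b) :
    (q * a + b) ^ p ≤ ((1 + q) / 2) ^ p * a ^ p + (2 / (1 - q)) ^ p * b ^ p := by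
  have h1q : 0 < 1 - q := by linarith
  have hR1 : 0 ≤ ((1 + q) / 2) ^ p * a ^ p := by positivity
  have hR2 : 0 ≤ (2 / (1 - q)) ^ p * b ^ p := by positivity
  rcases le_total b ((1 - q) / 2 * a) with h | h
  · have : (q * a + b) ^ p ≤ ((1 + q) / 2 * a) ^ p :=
      Real.rpow_le_rpow (by positivity) (by linarith) hp.le
    rw [Real.mul_rpow (by positivity) ha] at this
    linarith
  · have : (q * a + b) ^ p ≤ (2 / (1 - q) * b) ^ p := by
      refine Real.rpow_le_rpow (by positivity) ?_ hp.le
      have h2 : a ≤ 2 / (1 - q) * b := by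
        rw [div_mul_eq_mul_div, le_div_iff₀ h1q]; linarith
      have h3 : 2 / (1 - q) * b = q * (2 / (1 - q) * b) + 2 * b := by field_simp; ring
      nlinarith
    rw [Real.mul_rpow (by positivity) hb] at this
    linarith

theorem lintegral_lt_top_of_deriv {α : ℝ} (hα : 0 < α) {p : ℝ} (hp : 0 < p) {f : ℂ → ℂ}
    (hf : Differentiable ℂ f) {B : ℂ → ℝ} (hB0 : ∀ z, 0 ≤ B z)
    (hB : ∀ z, ∀ w ∈ closedBall z 1, gaussianNorm α (deriv f) w / (1 + ‖w‖) ≤ B z)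
    (hBint : ∫⁻ z, ENNReal.ofReal (B z ^ p) < ∞) :
    ∫⁻ z, ENNReal.ofReal (gaussianNorm α f z ^ p) < ∞ := by
  set q := Real.exp (-(α / 2)) with hq
  have hq0 : 0 < q := Real.exp_pos _
  have hq1 : q < 1 := Real.exp_zero ▸ Real.exp_lt_exp.2 (by linarith)
  set φ : ℂ → ℝ≥0∞ := fun z => ENNReal.ofReal (gaussianNorm α f z ^ p) with hφ
  have hFc := continuous_gaussianNorm α hf.continuous
  have hφc : Continuous φ :=
    ENNReal.continuous_ofReal.comp (hFc.rpow_const fun _ => Or.inr hp.le)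
  set Q : ℝ≥0∞ := ENNReal.ofReal (((1 + q) / 2) ^ p) with hQ
  have hQ1 : Q < 1 := by
    rw [hQ, ENNReal.ofReal_lt_one]
    exact Real.rpow_lt_one (by positivity) (by linarith) hp
  set D : ℝ≥0∞ := ENNReal.ofReal ((2 / (1 - q)) ^ p * 2 ^ p) with hD
  have hballfin : ∀ R : ℝ, ∫⁻ z in closedBall (0 : ℂ) R, φ z ≠ ∞ := fun R => by
    obtain ⟨M, hM⟩ := (isCompact_closedBall (0 : ℂ) R).exists_bound_of_continuousOn
      (hFc.rpow_const fun _ => Or.inr hp.le).continuousOn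
    refine ne_top_of_le_ne_top ?_ (setLIntegral_mono' (g := fun _ => ENNReal.ofReal M)
      measurableSet_closedBall fun z hz =>
        ENNReal.ofReal_le_ofReal ((le_abs_self _).trans (hM z hz)))
    rw [setLIntegral_const]
    exact ENNReal.mul_ne_top ENNReal.ofReal_ne_top measure_closedBall_lt_top.ne
  have hstep : ∀ z : ℂ, 1 < ‖z‖ →
      φ z ≤ Q * φ (radialShift z) + D * ENNReal.ofReal (B z ^ p) := by
    intro z hz
    have hF := gaussianNorm_nonneg α f (radialShift z)
    have h1 := gaussianNorm_le_radialShift hα hf hz.le (hB z)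
    have h2 := (Real.rpow_le_rpow (gaussianNorm_nonneg _ _ _) h1 hp.le).trans
      (rpow_mul_add_le hq0.le hq1 hp hF (mul_nonneg zero_le_two (hB0 z)))
    rw [Real.mul_rpow zero_le_two (hB0 z), ← mul_assoc] at h2
    have h1q : 0 < 1 - q := by linarith
    have hBz := hB0 z
    calc φ z ≤ _ := ENNReal.ofReal_le_ofReal h2
      _ = _ := by
        rw [ENNReal.ofReal_add (by positivity) (by positivity), ENNReal.ofReal_mul (by positivity),
          ENNReal.ofReal_mul (by positivity)]
  set K : ℝ≥0∞ := (∫⁻ z in closedBall (0 : ℂ) 1, φ z) + D * ∫⁻ z, ENNReal.ofReal (B z ^ p) with hK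
  have hKfin : K ≠ ∞ := ENNReal.add_ne_top.2
    ⟨hballfin 1, ENNReal.mul_ne_top ENNReal.ofReal_ne_top hBint.ne⟩
  -- Truncating to discs makes the integral finite, so it may be subtracted; each disc is stable
  -- under the shift, and the bound does not depend on n.
  have hbound : ∀ n : ℕ, ∫⁻ z in closedBall (0 : ℂ) n, φ z ≤ K / (1 - Q) := by
    intro n
    set X := ∫⁻ z in closedBall (0 : ℂ) n, φ z with hX
    set ψ : ℂ → ℝ≥0∞ := (closedBall (0 : ℂ) n).indicator φ with hψ
    have hψm : Measurable ψ := hφc.measurable.indicator measurableSet_closedBall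
    have hXψ : ∫⁻ z, ψ z = X := lintegral_indicator measurableSet_closedBall _
    have hS : MeasurableSet {z : ℂ | 1 < ‖z‖} := measurableSet_lt (by fun_prop) (by fun_prop)
    have hpt : ∀ z, ψ z ≤ ((closedBall (0 : ℂ) 1).indicator φ z +
        Q * {z : ℂ | 1 < ‖z‖}.indicator (fun z => ψ (radialShift z)) z) +
          D * ENNReal.ofReal (B z ^ p) := by
      intro z
      by_cases hz : 1 < ‖z‖
      · by_cases hzn : z ∈ closedBall (0 : ℂ) n
        · have hzn' : radialShift z ∈ closedBall (0 : ℂ) n := by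
            rw [mem_closedBall_zero_iff] at hzn ⊢
            refine le_trans ?_ hzn
            exact (sq_le_sq₀ (norm_nonneg _) (norm_nonneg _)).1
              (by rw [norm_sq_radialShift hz.le]; linarith)
          rw [indicator_of_mem (s := {z : ℂ | 1 < ‖z‖}) (by exact hz), hψ,
            indicator_of_mem hzn, indicator_of_mem hzn', add_assoc]
          exact (hstep z hz).trans le_add_self
        · rw [hψ, indicator_of_notMem hzn]; exact zero_le
      · have hz1 : z ∈ closedBall (0 : ℂ) 1 := by
          rw [mem_closedBall_zero_iff]; exact not_lt.1 hz
        rw [indicator_of_mem hz1, add_assoc]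
        exact (indicator_le_self _ _ z).trans le_self_add
    have hXle : X ≤ Q * X + K := by
      have h1 := lintegral_mono (μ := (volume : Measure ℂ)) hpt
      rw [hXψ, lintegral_add_left, lintegral_add_left, lintegral_const_mul' _ _ ENNReal.ofReal_ne_top,
        lintegral_const_mul' _ _ ENNReal.ofReal_ne_top, lintegral_indicator measurableSet_closedBall,
        lintegral_indicator hS, lintegral_radialShift hψm, hXψ] at h1
      · refine h1.trans (le_of_eq ?_)
        rw [hK]; ring
      · exact hφc.measurable.indicator measurableSet_closedBall
      · exact (hφc.measurable.indicator measurableSet_closedBall).add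
          (((hψm.comp measurable_radialShift).indicator hS).const_mul _)
    rw [ENNReal.le_div_iff_mul_le (Or.inl (tsub_pos_of_lt hQ1).ne')
      (Or.inl (ne_top_of_le_ne_top ENNReal.one_ne_top tsub_le_self)), mul_comm,
      ENNReal.sub_mul fun _ _ => hballfin n, one_mul]
    exact tsub_le_iff_left.2 hXle
  have hunion : ⋃ n : ℕ, closedBall (0 : ℂ) n = univ := iUnion_closedBall_nat 0
  rw [← setLIntegral_univ, ← hunion, setLIntegral_iUnion_of_directed]
  · refine (iSup_le hbound).trans_lt (ENNReal.div_lt_top hKfin (tsub_pos_of_lt hQ1).ne')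
  · exact (monotone_nat_of_le_succ fun n =>
      closedBall_subset_closedBall (by push_cast; linarith)).directed_le

theorem exists_gaussianNorm_le_of_deriv {α : ℝ} (hα : 0 < α) {f : ℂ → ℂ}
    (hf : Differentiable ℂ f) {B : ℝ}
    (hB : ∀ w, gaussianNorm α (deriv f) w / (1 + ‖w‖) ≤ B) :
    ∃ K, ∀ z, gaussianNorm α f z ≤ K := by
  set q := Real.exp (-(α / 2)) with hq
  have hq0 : 0 < q := Real.exp_pos _
  have h1q : 0 < 1 - q := sub_pos.2 (Real.exp_zero ▸ Real.exp_lt_exp.2 (by linarith))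
  obtain ⟨M, hM⟩ := (isCompact_closedBall (0 : ℂ) 1).exists_bound_of_continuousOn
    (continuous_gaussianNorm α hf.continuous).continuousOn
  -- The second entry is what gives qK + 2B ≤ K.
  set K := max M (2 * B / (1 - q)) with hK
  have hKB : 2 * B ≤ K * (1 - q) := (div_le_iff₀ h1q).1 (le_max_right _ _)
  -- Each shift lowers |z|² by 1, so the induction ends in the unit disc.
  have key : ∀ n : ℕ, ∀ z : ℂ, ‖z‖ ^ 2 ≤ n + 1 → gaussianNorm α f z ≤ K := by
    intro n
    induction n with
    | zero =>
      intro z hz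
      refine ((le_abs_self _).trans (hM z ?_)).trans (le_max_left _ _)
      rw [mem_closedBall_zero_iff]
      nlinarith [norm_nonneg z, show ((0 : ℕ) : ℝ) = 0 from Nat.cast_zero]
    | succ n ih =>
      intro z hz
      rcases le_total ‖z‖ 1 with h1 | h1
      · refine ((le_abs_self _).trans (hM z ?_)).trans (le_max_left _ _)
        rwa [mem_closedBall_zero_iff]
      · have h2 := ih (radialShift z) (by
          rw [norm_sq_radialShift h1]; push_cast at hz; linarith)
        have h3 := gaussianNorm_le_radialShift hα hf h1 fun w _ => hB w
        nlinarith
  refine ⟨K, fun z => ?_⟩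
  obtain ⟨n, hn⟩ := exists_nat_ge (‖z‖ ^ 2)
  exact key n z (by linarith)

theorem theorem9 (f : ℂ → ℂ) (hf : Differentiable ℂ f) (α : ℝ) (hα : 0 < α)
    (p : ℝ≥0∞) (hp : 0 < p) :
    f ∈ fockSpace α p ↔
      (fun z : ℂ => deriv f z / ((1 + ‖z‖ : ℝ) : ℂ)) ∈ gaussianLp α p := by
  have hf' : Differentiable ℂ (deriv f) :=
    (hf.contDiff (n := 2)).differentiable_deriv_two
  have hpos : ∀ z : ℂ, 0 < 1 + ‖z‖ := fun z => by positivity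
  have hc : Continuous fun z : ℂ => f z * ((Real.exp (-(α * ‖z‖ ^ 2 / 2)) : ℝ) : ℂ) := by
    have := hf.continuous
    fun_prop
  have hc' : Continuous fun z : ℂ => deriv f z / ((1 + ‖z‖ : ℝ) : ℂ) *
      ((Real.exp (-(α * ‖z‖ ^ 2 / 2)) : ℝ) : ℂ) := by
    have h1 : Continuous fun z : ℂ => deriv f z / ((1 + ‖z‖ : ℝ) : ℂ) :=
      hf'.continuous.div (by fun_prop) fun z => Complex.ofReal_ne_zero.2 (hpos z).ne'
    fun_prop
  have hn : ∀ z : ℂ, ‖f z * ((Real.exp (-(α * ‖z‖ ^ 2 / 2)) : ℝ) : ℂ)‖ = gaussianNorm α f z := by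
    intro z
    rw [norm_mul, Complex.norm_real, Real.norm_of_nonneg (Real.exp_pos _).le, gaussianNorm]
  have hn' : ∀ z : ℂ, ‖deriv f z / ((1 + ‖z‖ : ℝ) : ℂ) *
      ((Real.exp (-(α * ‖z‖ ^ 2 / 2)) : ℝ) : ℂ)‖ = gaussianNorm α (deriv f) z / (1 + ‖z‖) := by
    intro z
    rw [norm_mul, norm_div, Complex.norm_real, Complex.norm_real,
      Real.norm_of_nonneg (Real.exp_pos _).le, Real.norm_of_nonneg (hpos z).le, gaussianNorm]
    ring
  have hmem : f ∈ fockSpace α p ↔ f ∈ gaussianLp α p := and_iff_left hf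
  rw [hmem]
  simp only [gaussianLp, mem_ofPred_eq]
  rcases eq_or_ne p ∞ with rfl | hp'
  · rw [memLp_top_iff_of_continuous hc, memLp_top_iff_of_continuous hc']
    simp only [hn, hn']
    constructor
    · rintro ⟨B, hB⟩
      exact ⟨_, fun z => gaussianNorm_deriv_div_le hα hf z fun w _ => hB w⟩
    · rintro ⟨B, hB⟩
      exact exists_gaussianNorm_le_of_deriv hα hf hB
  · rw [memLp_iff_lintegral_of_continuous hc hp.ne' hp',
      memLp_iff_lintegral_of_continuous hc' hp.ne' hp']
    simp only [hn, hn']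
    have hpr : 0 < p.toReal := ENNReal.toReal_pos hp.ne' hp'
    constructor
    · intro h
      obtain ⟨B, hB0, hB, hBint⟩ := exists_local_bound hα hpr (v := fun _ => 1)
        (fun _ => one_pos) (fun _ _ _ => by norm_num) continuous_const hf (by simpa using h)
      simp only [div_one] at hB
      set c := Real.exp (α / 2) + α with hc
      have hc0 : 0 ≤ c := by positivity
      refine lt_of_le_of_lt (lintegral_mono (g := fun z => ENNReal.ofReal (c ^ p.toReal) *
        ENNReal.ofReal (B z ^ p.toReal)) fun z => ?_) ?_
      · have hBz := hB0 z
        beta_reduce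
        rw [← ENNReal.ofReal_mul (by positivity), ← Real.mul_rpow hc0 hBz]
        exact ENNReal.ofReal_le_ofReal (Real.rpow_le_rpow
          (div_nonneg (gaussianNorm_nonneg _ _ _) (hpos z).le)
          (gaussianNorm_deriv_div_le hα hf z (hB z)) hpr.le)
      · rw [lintegral_const_mul' _ _ ENNReal.ofReal_ne_top]
        exact ENNReal.mul_lt_top ENNReal.ofReal_lt_top hBint
    · intro h
      -- The weight 1 + |z| at most doubles over unit distance, since |w| ≤ |z| + 1.
      obtain ⟨B, hB0, hB, hBint⟩ := exists_local_bound hα hpr (v := fun z => 1 + ‖z‖) hpos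
        (fun z w hw => by
          have := norm_add_le z (w - z)
          rw [add_sub_cancel, ← dist_eq_norm] at this
          linarith [norm_nonneg z]) (by fun_prop) hf' h
      exact lintegral_lt_top_of_deriv hα hpr hf hB0 hB hBint
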